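/- A generalised triangulation $\mathcal{T}$ of dimension $d$ is a finite set of abstract $d$-simplices together with a set of gluings, each gluing being an affine identification of two distinct $(d-1)$-faces of these simplices (possibly of the same simplex), determined by a pairing of their vertices, such that each $(d-1)$-face is used in at most one gluing. It is closed if every $(d-1)$-face is used in a gluing, and connected if its underlying space $|\mathcal{T}|$ (the disjoint union of the simplices modulo the gluings) is non-empty and connected. Let $f_i$ be the number of $i$-dimensional faces of $\mathcal{T}$ after the identifications, and let $\delta_{\mathcal{T}} := f_0 - \frac{f_d}{2}$. The dual graph $\Gamma(\mathcal{T})$ is the multigraph (loops and multiple arcs allowed) with a node for each $d$-simplex and an arc for each gluing, linking the two simplices glued together. Let $\Gamma$ be a connected multigraph. A node $v$ is separating if there are subgraphs $\Gamma_1,\Gamma_2$ of $\Gamma$, each with at least one arc, such that every arc of $\Gamma$ is contained in exactly one of them and $v$ is their only common node. A connected graph is non-separable if it has no separating node; a non-separable component of $\Gamma$ is a maximal non-separable subgraph. The block-separating tree of $\Gamma$ has a node for each separating node and each non-separable component of $\Gamma$, and an arc from each separating node to each component containing it. The branching number $\mathrm{branch}(\Gamma)$ is $1$ if $\Gamma$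 is non-separable with exactly one node, $2$ if $\Gamma$ is non-separable with at least two nodes, and otherwise the number of leaves of the block-separating tree of $\Gamma$. **Theorem.** Let $d \geq 2$ be even, and let $\mathcal{T}$ be a closed and connected generalised triangulation of dimension $d$. Then $$\delta_{\mathcal{T}} \;=\; f_0 - \frac{f_d}{2} \;\leq\; d + \left\lfloor \frac{\mathrm{branch}(\Gamma(\mathcal{T})) - 2}{d-1} \right\rfloor .$$ Consequently, if $\mathrm{branch}(\Gamma(\mathcal{T})) \leq d$, then $f_0 \leq \frac{f_d}{2} + d$. -/

import Mathlib

open scoped Graph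

universe u v

/-! ### Multigraphs: separating nodes, non-separable components, branching number

Graphs may have loops and multiple arcs; they are Mathlib's `Graph α β`, where `G ≤ H` means that
`G` is a subgraph of `H`. -/

namespace BranchGraph

variable {α : Type u} {β : Type v}

/-- `G` is connected: it has a node, and any two nodes are joined by a path. -/
def IsConnected (G : Graph α β) : Prop :=
  V(G).Nonempty ∧ ∀ x ∈ V(G), ∀ y ∈ V(G), Relation.ReflTransGen G.Adj x y

/-- `w` is a separating node of `G`: there are subgraphs `G₁` and `G₂`, each with at least one arc,
such that every arc of `G` is in exactly one of them and `w` is their only common node. -/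
def IsSeparatingNode (G : Graph α β) (w : α) : Prop :=
  ∃ G₁ G₂ : Graph α β, G₁ ≤ G ∧ G₂ ≤ G ∧ E(G₁).Nonempty ∧ E(G₂).Nonempty ∧
    E(G₁) ∪ E(G₂) = E(G) ∧ Disjoint E(G₁) E(G₂) ∧ V(G₁) ∩ V(G₂) = {w}

/-- A graph is non-separable if it is connected and has no separating nodes. -/
def IsNonseparable (G : Graph α β) : Prop :=
  IsConnected G ∧ ∀ w, ¬ IsSeparatingNode G w

/-- A non-separable component of `G` is a maximal non-separable subgraph of `G`. -/
def IsNonseparableComponent (G H : Graph α β) : Prop :=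
  Maximal (fun K : Graph α β => K ≤ G ∧ IsNonseparable K) H

/-- The block-separating tree of `G`: one node for each separating node and one for each
non-separable component, and an arc from each separating node to each component containing it. -/
def blockSeparatingTree (G : Graph α β) :
    SimpleGraph ({w : α // IsSeparatingNode G w} ⊕
      {H : Graph α β // IsNonseparableComponent G H}) :=
  SimpleGraph.fromRel fun x y => ∃ w H, x = Sum.inl w ∧ y = Sum.inr H ∧ w.1 ∈ V(H.1)

/-- The number of leaves (nodes with exactly one neighbour) of the block-separating tree. -/
noncomputable def numLeaves (G : Graph α β) : ℕ :=
  {x | ((blockSeparatingTree G).neighborSet x).ncard = 1}.ncard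

open Classical in
/-- The branching number of a (connected) graph. -/
noncomputable def branch (G : Graph α β) : ℕ :=
  if IsNonseparable G ∧ V(G).ncard = 1 then 1
  else if IsNonseparable G ∧ 2 ≤ V(G).ncard then 2
  else numLeaves G

end BranchGraph

/-! ### Generalised triangulations -/

/-- A (generalised) triangulation of dimension `d`: a finite set of abstract `d`-simplices, each with
vertices `0, …, d`, and a set of gluings. The `(d-1)`-face of the simplex `σ` opposite to its vertex
`i` is written `(σ, i)`. A gluing `e` identifies the `(d-1)`-faces `src e` and `tgt e` by a pairing
`pairing e` of their vertices (which of the two is called the source is immaterial). -/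
structure GenTriangulation (d : ℕ) where
  /-- the `d`-simplices -/
  Simplex : Type u
  finite_simplex : Finite Simplex
  /-- the gluings -/
  Gluing : Type v
  src : Gluing → Simplex × Fin (d + 1)
  tgt : Gluing → Simplex × Fin (d + 1)
  pairing : ∀ e, {k : Fin (d + 1) // k ≠ (src e).2} ≃ {k : Fin (d + 1) // k ≠ (tgt e).2}
  /-- no `(d-1)`-face is glued to itself, and each `(d-1)`-face is used in at most one gluing -/
  face_used_once : Function.Injective (Sum.elim src tgt)

namespace GenTriangulation

variable {d : ℕ}

/-- A triangulation is closed if every `(d-1)`-face is used in a gluing. -/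
def IsClosedTriangulation (T : GenTriangulation.{u, v} d) : Prop :=
  ∀ r : T.Simplex × Fin (d + 1), ∃ e, T.src e = r ∨ T.tgt e = r

/-- A gluing identifies a point of its source face with the point of its target face that has the
same barycentric coordinates with respect to paired vertices. -/
def PointGlued (T : GenTriangulation.{u, v} d)
    (p q : (_ : T.Simplex) × stdSimplex ℝ (Fin (d + 1))) : Prop :=
  ∃ e, p.1 = (T.src e).1 ∧ q.1 = (T.tgt e).1 ∧
    p.2 (T.src e).2 = 0 ∧ q.2 (T.tgt e).2 = 0 ∧
    ∀ k : {k : Fin (d + 1) // k ≠ (T.src e).2}, q.2 (T.pairing e k).1 = p.2 k.1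

/-- The underlying topological space `|T|`: the disjoint union of the geometric simplices
(`T.Simplex` being discrete) modulo the equivalence relation generated by the gluings. -/
def Realization (T : GenTriangulation.{u, v} d) : Type u :=
  Quot T.PointGlued

instance (T : GenTriangulation.{u, v} d) : TopologicalSpace T.Realization :=
  inferInstanceAs (TopologicalSpace (Quot T.PointGlued))

/-- A triangulation is connected if its underlying space is connected (in particular non-empty). -/
def IsConnectedTriangulation (T : GenTriangulation.{u, v} d) : Prop :=
  ConnectedSpace T.Realization

/-- The `i`-dimensional faces of the abstract simplices, given by their `i + 1` vertices. -/
def PreFace (T : GenTriangulation.{u, v} d) (i : ℕ) : Type u :=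
  T.Simplex × {A : Finset (Fin (d + 1)) // A.card = i + 1}

/-- A gluing identifies each face contained in its source with the corresponding face contained in
its target. -/
def FaceGlued (T : GenTriangulation.{u, v} d) (i : ℕ) (p q : T.PreFace i) : Prop :=
  ∃ e, p.1 = (T.src e).1 ∧ q.1 = (T.tgt e).1 ∧
    (T.src e).2 ∉ p.2.1 ∧ (T.tgt e).2 ∉ q.2.1 ∧
    ∀ k : {k : Fin (d + 1) // k ≠ (T.src e).2}, k.1 ∈ p.2.1 ↔ (T.pairing e k).1 ∈ q.2.1

/-- The `i`-dimensional faces of `T`: the faces of the simplices after the identifications. -/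
def Face (T : GenTriangulation.{u, v} d) (i : ℕ) : Type u :=
  Quot (T.FaceGlued i)

/-- The entry `f_i` of the `f`-vector. -/
noncomputable def f (T : GenTriangulation.{u, v} d) (i : ℕ) : ℕ :=
  Nat.card (T.Face i)

/-- `δ_T = f_0 - f_d / 2`. -/
noncomputable def delta (T : GenTriangulation.{u, v} d) : ℚ :=
  (T.f 0 : ℚ) - (T.f d : ℚ) / 2

/-- The dual graph `Γ(T)`: a node for each `d`-simplex and an arc for each gluing, which links the two
(possibly equal) simplices that are glued. -/
def dualGraph (T : GenTriangulation.{u, v} d) : Graph T.Simplex T.Gluing where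
  vertexSet := Set.univ
  IsLink e x y := s((T.src e).1, (T.tgt e).1) = s(x, y)
  edgeSet := Set.univ
  isLink_symm := fun _ _ => ⟨fun _ _ h => h.trans Sym2.eq_swap⟩
  eq_or_eq_of_isLink_of_isLink := by
    intro e x y v w h h'
    have := h.symm.trans h'
    rw [Sym2.eq_iff] at this
    tauto
  edge_mem_iff_exists_isLink := fun e => ⟨fun _ => ⟨_, _, rfl⟩, fun _ => Set.mem_univ e⟩
  left_mem_of_isLink := fun _ _ _ _ => Set.mem_univ _

end GenTriangulation

/-! Give the simplices distinct heights so that every simplex except a root `r` is glued to a lower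
one. Let `σ ≠ r` be the lowest simplex containing a vertex `v`. A facet of `σ` that contains `v`
leads to another simplex containing `v`, so only the facet opposite `v` can be glued downwards.
Hence `f_0` is at most the number of vertices of `r` plus the number `a` of non-root simplices of
in-degree one (`f_zero_le`).

In- and out-degrees have equal sums, and in-degree, out-degree and loop-degree add up to `d + 1` at
each simplex. Balancing them gives `2(d-1)a + 2d ≤ (d-1)f_d + 2s + 2l`, with `s` loopless sinks and
`l` loops (`inDeg_eq_one_bound`).

It remains to find an order with `s + l` small (`exists_order_le_branch`). Adding ears one at a
time, as for an st-numbering, yields an order whose sinks lie in any prescribed set that meets every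
set of nodes avoiding `r` with at most one outer neighbour (`exists_order_of_sinks`). Minimal
loopless sets of this kind come from leaf blocks of the block-separating tree, and in a graph with
another arc each loop is a leaf too. Placing `r` at a loop or inside a leaf block of a separable
graph supplies the needed slack.

Evenness of `d` makes `f_d` even, so `δ` is an integer and the floor may be taken. -/

/-! ### Bipolar orders built from ears. -/

namespace SimpleGraph

variable {V : Type*}

/-- A list of nodes that starts with `s` and ends with `t`, and in which every other node has both an
earlier and a later neighbour. -/
def IsBipolarList (A : SimpleGraph V) (s t : V) (l : List V) : Prop :=
  l.Nodup ∧ (∃ m, l = s :: (m ++ [t])) ∧ ∀ v ∈ l, v ≠ s → v ≠ t →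
    (∃ u, [u, v].Sublist l ∧ A.Adj u v) ∧ ∃ w, [v, w].Sublist l ∧ A.Adj v w

theorem exists_adj_of_isChain {A : SimpleGraph V} {x y v : V} {p : List V}
    (hp : (x :: (p ++ [y])).IsChain A.Adj) (hv : v ∈ p) :
    (∃ u, [u, v].Sublist (x :: (p ++ [y])) ∧ A.Adj u v) ∧
      ∃ w, [v, w].Sublist (x :: (p ++ [y])) ∧ A.Adj v w := by
  obtain ⟨p₁, p₂, rfl⟩ := List.append_of_mem hv
  constructor
  · obtain ⟨q, u, hq⟩ : ∃ q u, x :: p₁ = q ++ [u] :=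
      ⟨_, _, (List.dropLast_append_getLast (List.cons_ne_nil x p₁)).symm⟩
    have e : x :: (p₁ ++ v :: p₂ ++ [y]) = q ++ u :: v :: (p₂ ++ [y]) := by
      have := congrArg (· ++ v :: (p₂ ++ [y])) hq
      simpa using this
    rw [e] at hp ⊢
    refine ⟨u, ?_, (List.isChain_append_cons_cons.1 hp).2.1⟩
    exact (List.Sublist.trans (by simp) (List.sublist_append_right q _))
  · obtain ⟨w, q, hq⟩ : ∃ w q, p₂ ++ [y] = w :: q := by
      cases p₂ with
      | nil => exact ⟨_, _, rfl⟩
      | cons a b => exact ⟨_, _, rfl⟩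
    have e : x :: (p₁ ++ v :: p₂ ++ [y]) = (x :: p₁) ++ v :: w :: q := by
      simp [hq]
    rw [e] at hp ⊢
    refine ⟨w, ?_, (List.isChain_append_cons_cons.1 hp).2.1⟩
    exact (List.Sublist.trans (by simp) (List.sublist_append_right _ _))

/-- The ear `p` from `x` to the later node `y` is placed directly after `x`. Its nodes find their
earlier and later neighbours along the ear, and older nodes keep theirs. -/
theorem IsBipolarList.insert {A : SimpleGraph V} {s t x y : V} {l₁ l₂ p : List V}
    (h : A.IsBipolarList s t (l₁ ++ x :: l₂)) (hy : y ∈ l₂) (hp : p.Nodup)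
    (hd : ∀ v ∈ p, v ∉ l₁ ++ x :: l₂) (hc : (x :: (p ++ [y])).IsChain A.Adj) :
    A.IsBipolarList s t (l₁ ++ x :: (p ++ l₂)) := by
  obtain ⟨hn, ⟨m, hm⟩, hadj⟩ := h
  have hsub : (l₁ ++ x :: l₂).Sublist (l₁ ++ x :: (p ++ l₂)) := by simp
  have hsub' : (x :: (p ++ [y])).Sublist (l₁ ++ x :: (p ++ l₂)) := by
    refine List.Sublist.trans ?_ (List.sublist_append_right l₁ _)
    simpa using hy
  refine ⟨?_, ?_, ?_⟩
  · have hperm : (l₁ ++ x :: (p ++ l₂)).Perm (p ++ (l₁ ++ x :: l₂)) := by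
      have h1 : (l₁ ++ x :: (p ++ l₂)) = (l₁ ++ [x]) ++ (p ++ l₂) := by simp
      have h2 : (p ++ (l₁ ++ x :: l₂)) = (p ++ (l₁ ++ [x])) ++ l₂ := by simp
      rw [h1, h2, ← List.append_assoc]
      exact (List.perm_append_comm).append_right _
    rw [hperm.nodup_iff, List.nodup_append']
    exact ⟨hp, hn, fun v hv => hd v hv⟩
  · obtain ⟨q, hq⟩ : ∃ q, l₂ = q ++ [t] := by
      have hne : l₂ ≠ [] := List.ne_nil_of_mem hy
      refine ⟨l₂.dropLast, ?_⟩
      have : (l₁ ++ x :: l₂).getLast (by simp) = (s :: (m ++ [t])).getLast (by simp) := by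
        simp only [hm]
      have h2 : l₂.getLast hne = t := by simpa [hne] using this
      rw [← h2]; exact (List.dropLast_append_getLast hne).symm
    cases l₁ with
    | nil =>
      simp only [List.nil_append, List.cons.injEq] at hm
      exact ⟨p ++ q, by simp [hm.1, hq]⟩
    | cons a l =>
      simp only [List.cons_append, List.cons.injEq] at hm
      exact ⟨l ++ x :: (p ++ q), by simp [hm.1, hq]⟩
  · intro v hv hvs hvt
    by_cases hvp : v ∈ p
    · obtain ⟨⟨u, hu, hu'⟩, w, hw, hw'⟩ := exists_adj_of_isChain hc hvp
      exact ⟨⟨u, hu.trans hsub', hu'⟩, w, hw.trans hsub', hw'⟩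
    · have : v ∈ l₁ ++ x :: l₂ := by
        simp only [List.mem_append, List.mem_cons] at hv ⊢
        tauto
      obtain ⟨⟨u, hu, hu'⟩, w, hw, hw'⟩ := hadj v this hvs hvt
      exact ⟨⟨u, hu.trans hsub, hu'⟩, w, hw.trans hsub, hw'⟩

/-- `A` has no node cut of size less than two that leaves a part avoiding both `s` and `t`. -/
def NoSmallCut (A : SimpleGraph V) (s t : V) : Prop :=
  ∀ X : Set V, X.Nonempty → s ∉ X → t ∉ X →
    ∃ x y, x ≠ y ∧ x ∉ X ∧ y ∉ X ∧ (∃ a ∈ X, A.Adj x a) ∧ ∃ b ∈ X, A.Adj y b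

/-- The component of `z` outside the list has two distinct attachments, necessarily on the list. A
path through the component between them is an ear. -/
theorem IsBipolarList.extend {A : SimpleGraph V} {s t z : V} {l : List V}
    (hcut : A.NoSmallCut s t) (h : A.IsBipolarList s t l) (hz : z ∉ l) :
    ∃ l', A.IsBipolarList s t l' ∧ l.length < l'.length := by
  set H := A.induce {v | v ∉ l} with hH
  set X : Set V := {v | ∃ hv : v ∉ l, H.Reachable ⟨z, hz⟩ ⟨v, hv⟩} with hX
  have hs : s ∈ l := by obtain ⟨-, ⟨m, rfl⟩, -⟩ := h; simp
  have ht : t ∈ l := by obtain ⟨-, ⟨m, rfl⟩, -⟩ := h; simp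
  obtain ⟨x, y, hxy, hx, hy, ⟨a, ⟨ha, hra⟩, hxa⟩, b, ⟨hb, hrb⟩, hyb⟩ :=
    hcut X ⟨z, hz, Reachable.refl _⟩ (fun h => h.1 hs) (fun h => h.1 ht)
  have hxl : x ∈ l := by
    by_contra hxl
    refine hx ⟨hxl, hra.trans (Adj.reachable ?_)⟩
    exact hxa.symm
  have hyl : y ∈ l := by
    by_contra hyl
    refine hy ⟨hyl, hrb.trans (Adj.reachable ?_)⟩
    exact hyb.symm
  have key : ∀ x y a b (ha : a ∉ l) (hb : b ∉ l), H.Reachable ⟨z, hz⟩ ⟨a, ha⟩ →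
      H.Reachable ⟨z, hz⟩ ⟨b, hb⟩ → A.Adj x a → A.Adj y b →
      (∃ l₁ l₂, l = l₁ ++ x :: l₂ ∧ y ∈ l₂) →
      ∃ l', A.IsBipolarList s t l' ∧ l.length < l'.length := by
    rintro x y a b ha hb hra hrb hxa hyb ⟨l₁, l₂, hl, hyl₂⟩
    obtain ⟨p, hp⟩ := (hra.symm.trans hrb).exists_isPath
    have hch : (p.support.map Subtype.val).IsChain A.Adj := by
      rw [List.isChain_map]
      exact p.isChain_adj_support
    refine ⟨l₁ ++ x :: (p.support.map Subtype.val ++ l₂), ?_, ?_⟩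
    · subst hl
      refine h.insert hyl₂ (hp.support_nodup.map Subtype.val_injective) ?_ ?_
      · intro v hv
        obtain ⟨w, -, rfl⟩ := List.mem_map.1 hv
        exact w.2
      · rw [← List.cons_append, List.isChain_append]
        refine ⟨?_, List.IsChain.singleton _, ?_⟩
        · rw [List.isChain_cons]
          refine ⟨?_, hch⟩
          intro v hv
          rw [List.head?_map, List.head?_eq_some_head p.support_ne_nil] at hv
          simp at hv
          exact hv ▸ hxa
        · intro u hu v hv
          rw [List.getLast?_cons, List.getLast?_map,
            List.getLast?_eq_some_getLast p.support_ne_nil] at hu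
          simp at hu hv
          subst hu hv
          exact hyb.symm
    · have : 0 < p.support.length := List.length_pos_iff.2 p.support_ne_nil
      simp only [hl, List.length_append, List.length_cons, List.length_map]
      omega
  obtain ⟨l₁, l₂, hl⟩ := List.append_of_mem hxl
  have : y ∈ l₁ ∨ y ∈ l₂ := by
    rw [hl] at hyl
    simp only [List.mem_append, List.mem_cons] at hyl
    have := hxy.symm
    tauto
  rcases this with hy1 | hy2
  · obtain ⟨m₁, m₂, rfl⟩ := List.append_of_mem hy1
    exact key y x b a hb ha hrb hra hyb hxa ⟨m₁, m₂ ++ x :: l₂, by simp [hl], by simp⟩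
  · exact key x y a b ha hb hra hrb hxa hyb ⟨l₁, l₂, hl, hy2⟩

theorem NoSmallCut.exists_isBipolarList [Finite V] {A : SimpleGraph V} {s t : V} (hst : s ≠ t)
    (hcut : A.NoSmallCut s t) : ∃ l, A.IsBipolarList s t l ∧ ∀ v, v ∈ l := by
  classical
  have := Fintype.ofFinite V
  by_contra! hcon
  have : ∀ k : ℕ, ∃ l, A.IsBipolarList s t l ∧ k ≤ l.length := by
    intro k
    induction k with
    | zero =>
      -- The end nodes carry no adjacency condition, so `s` and `t` need not be adjacent.
      refine ⟨[s, t], ⟨by simpa using hst, ⟨[], rfl⟩, ?_⟩, Nat.zero_le _⟩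
      intro v hv hvs hvt
      simp [hvs, hvt] at hv
    | succ k ih =>
      obtain ⟨l, hl, hk⟩ := ih
      obtain ⟨z, hz⟩ := hcon l hl
      obtain ⟨l', hl', hlt⟩ := hl.extend hcut hz
      exact ⟨l', hl', by omega⟩
  obtain ⟨l, hl, hk⟩ := this (Fintype.card V + 1)
  have := hl.1.length_le_card
  omega

/-- The outer boundary of a set of nodes. -/
def outerBoundary (A : SimpleGraph V) (X : Set V) : Set V := {y | y ∉ X ∧ ∃ x ∈ X, A.Adj y x}

theorem idxOf_lt_of_sublist [BEq V] [LawfulBEq V] {l : List V} (hl : l.Nodup) {u v : V}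
    (h : [u, v].Sublist l) : l.idxOf u < l.idxOf v := by
  obtain ⟨r₁, r₂, rfl, hu, hv⟩ := List.cons_sublist_iff.1 h
  rw [List.singleton_sublist] at hv
  have hv1 : v ∉ r₁ := fun h => (List.nodup_append'.1 hl).2.2 h hv
  rw [List.idxOf_append_of_mem hu, List.idxOf_append_of_notMem hv1]
  have := List.idxOf_lt_length_of_mem hu
  omega

/-- If `S` meets every nonempty set of nodes that avoids `r` and has at most one outer neighbour, then
the nodes can be ordered in such a way that `r` is the only source and all sinks are in `S`. -/
theorem exists_order_of_sinks [Finite V] (A : SimpleGraph V) (r : V) (S : Set V)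
    (hconn : ∀ X : Set V, X.Nonempty → r ∉ X → (A.outerBoundary X).Nonempty)
    (hS : ∀ X : Set V, X.Nonempty → r ∉ X → (A.outerBoundary X).Subsingleton → (X ∩ S).Nonempty) :
    ∃ h : V → ℕ, Function.Injective h ∧ (∀ v, v ≠ r → ∃ u, A.Adj u v ∧ h u < h v) ∧
      ∀ v, v ≠ r → v ∉ S → ∃ u, A.Adj v u ∧ h v < h u := by
  classical
  -- The extra node `none`, joined to all of `S`, serves as the target. A set with only one outer
  -- neighbour in `A` gains `none` as a second one, and a node whose only later neighbour is `none`
  -- lies in `S`.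
  let B : SimpleGraph (Option V) := SimpleGraph.fromRel fun x y =>
    (∃ a b, x = some a ∧ y = some b ∧ A.Adj a b) ∨ ∃ a ∈ S, x = some a ∧ y = none
  have hB1 : ∀ a b, B.Adj (some a) (some b) ↔ A.Adj a b := by
    intro a b
    simp only [B, fromRel_adj]
    constructor
    · rintro ⟨-, h⟩
      simpa [A.adj_comm b a] using h
    · intro h
      exact ⟨by simpa using h.ne, by simp [h]⟩
  have hB2 : ∀ a, B.Adj (some a) none ↔ a ∈ S := by
    intro a; simp [B, fromRel_adj]
  have hcut : B.NoSmallCut (some r) none := by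
    intro X hX hr hn
    set Y : Set V := {a | some a ∈ X}
    have hY : Y.Nonempty := by
      obtain ⟨x, hx⟩ := hX
      cases x with
      | none => exact (hn hx).elim
      | some a => exact ⟨a, hx⟩
    obtain ⟨c, hc, a, ha, hca⟩ := hconn Y hY hr
    by_cases hs : (A.outerBoundary Y).Subsingleton
    · obtain ⟨z, hz, hzS⟩ := hS Y hY hr hs
      exact ⟨some c, none, by simp, hc, hn, ⟨some a, ha, (hB1 _ _).2 hca⟩, some z, hz,
        ((hB2 z).2 hzS).symm⟩
    · rw [Set.not_subsingleton_iff] at hs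
      obtain ⟨x, ⟨hx, a, ha, hxa⟩, y, ⟨hy, b, hb, hyb⟩, hxy⟩ := hs
      exact ⟨some x, some y, by simpa using hxy, hx, hy, ⟨some a, ha, (hB1 _ _).2 hxa⟩, some b, hb,
        (hB1 _ _).2 hyb⟩
  obtain ⟨l, ⟨hn, ⟨m, hm⟩, hadj⟩, hall⟩ := hcut.exists_isBipolarList (by simp)
  refine ⟨fun v => l.idxOf (some v), ?_, ?_, ?_⟩
  · intro u v huv
    simpa using (List.idxOf_inj (hall (some u))).1 huv
  · intro v hv
    obtain ⟨⟨u, hu, hu'⟩, -⟩ := hadj (some v) (hall _) (by simpa using hv) (by simp)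
    cases u with
    | none =>
      exfalso
      have h1 := idxOf_lt_of_sublist hn hu
      have h2 : [some v, none].Sublist l := by
        have := hall (some v)
        rw [hm] at this ⊢
        rw [← List.cons_append] at this ⊢
        have : some v ∈ some r :: m := by simpa using this
        exact List.Sublist.append (List.singleton_sublist.2 this) (List.Sublist.refl _)
      have := idxOf_lt_of_sublist hn h2
      omega
    | some u => exact ⟨u, (hB1 _ _).1 hu', idxOf_lt_of_sublist hn hu⟩
  · intro v hv hvS
    obtain ⟨-, u, hu, hu'⟩ := hadj (some v) (hall _) (by simpa using hv) (by simp)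
    cases u with
    | none => exact (hvS ((hB2 v).1 hu')).elim
    | some u => exact ⟨u, (hB1 _ _).1 hu', idxOf_lt_of_sublist hn hu⟩

end SimpleGraph

/-! ### End pieces and the leaf blocks they span. -/

namespace BranchGraph

variable {α : Type u} {β : Type v} {G K : Graph α β} {X Y : Set α} {c w r x y z : α} {e : β}

/-- The simple graph underlying a multigraph. -/
def underlying (G : Graph α β) : SimpleGraph α where
  Adj x y := x ≠ y ∧ G.Adj x y
  symm := ⟨fun _ _ h => ⟨h.1.symm, h.2.symm⟩⟩
  loopless := ⟨fun _ h => h.1 rfl⟩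

/-- The nodes outside `X` that are adjacent to a node of `X`. -/
abbrev boundary (G : Graph α β) (X : Set α) : Set α := (underlying G).outerBoundary X

theorem mem_boundary : y ∈ boundary G X ↔ y ∉ X ∧ ∃ x ∈ X, G.Adj y x := by
  constructor
  · rintro ⟨hy, x, hx, hxy⟩
    exact ⟨hy, x, hx, hxy.2⟩
  · rintro ⟨hy, x, hx, hxy⟩
    exact ⟨hy, x, hx, fun h => hy (h ▸ hx), hxy⟩

theorem IsConnected.boundary_nonempty (hG : IsConnected G) (hV : V(G) = Set.univ)
    (hX : X.Nonempty) (hz : z ∉ X) : (boundary G X).Nonempty := by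
  obtain ⟨x, hx⟩ := hX
  have hxz := hG.2 x (hV ▸ Set.mem_univ x) z (hV ▸ Set.mem_univ z)
  by_contra hne
  have : ∀ y, Relation.ReflTransGen G.Adj x y → y ∈ X := by
    intro y hy
    induction hy with
    | refl => exact hx
    | tail _ hab ih =>
      by_contra hb
      exact hne ⟨_, mem_boundary.2 ⟨hb, _, ih, hab.symm⟩⟩
  exact hz (this z hxz)

theorem IsConnected.exists_adj (hK : IsConnected K) (hE : E(K).Nonempty) (hx : x ∈ V(K)) :
    ∃ y, K.Adj x y := by
  obtain ⟨e, he⟩ := hE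
  obtain ⟨a, b, hab⟩ := Graph.exists_isLink_of_mem_edgeSet he
  rcases Relation.ReflTransGen.cases_head (hK.2 x hx a hab.left_mem) with h | ⟨y, hy, -⟩
  · exact ⟨b, e, h ▸ hab⟩
  · exact ⟨y, hy⟩

/-- `X` is a set of nodes without loops whose only outer neighbour is `c`, that has no proper subset
with at most one outer neighbour, and that is avoided by some arc. -/
structure IsEndPiece (G : Graph α β) (X : Set α) (c : α) : Prop where
  nonempty : X.Nonempty
  boundary_eq : boundary G X = {c}
  loopless : ∀ x ∈ X, ∀ e, ¬ G.IsLink e x x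
  minimal : ∀ Y ⊆ X, Y.Nonempty → (boundary G Y).Subsingleton → Y = X
  avoided : ∃ e x y, G.IsLink e x y ∧ x ∉ X ∧ y ∉ X

namespace IsEndPiece

theorem notMem (h : IsEndPiece G X c) : c ∉ X := by
  have : c ∈ boundary G X := by rw [h.boundary_eq]; rfl
  exact this.1

theorem mem_insert (h : IsEndPiece G X c) (hx : x ∈ X) (hxy : G.Adj x y) : y ∈ insert c X := by
  by_cases hy : y ∈ X
  · exact Or.inr hy
  · have : y ∈ boundary G X := mem_boundary.2 ⟨hy, x, hx, hxy.symm⟩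
    rw [h.boundary_eq] at this
    exact Or.inl this

end IsEndPiece

/-- The subgraph that consists of the nodes of `X`, the node `c` and the arcs that meet `X`. -/
def endBlock (G : Graph α β) (X : Set α) (c : α) : Graph α β :=
  (G.induce (insert c X)).restrict {e | ∃ x ∈ X, G.Inc e x}

theorem vertexSet_endBlock : V(endBlock G X c) = insert c X := rfl

namespace IsEndPiece

theorem isLink_endBlock (h : IsEndPiece G X c) :
    (endBlock G X c).IsLink e x y ↔ G.IsLink e x y ∧ (x ∈ X ∨ y ∈ X) := by
  simp only [endBlock, Graph.restrict_isLink, Graph.induce_isLink, Set.mem_ofPred_eq]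
  constructor
  · rintro ⟨⟨z, hz, hez⟩, hxy, -, -⟩
    refine ⟨hxy, ?_⟩
    rcases hez.eq_or_eq_of_isLink hxy with rfl | rfl
    · exact Or.inl hz
    · exact Or.inr hz
  · rintro ⟨hxy, hx | hy⟩
    · exact ⟨⟨x, hx, hxy.inc_left⟩, hxy, Or.inr hx, h.mem_insert hx hxy.adj⟩
    · exact ⟨⟨y, hy, hxy.inc_right⟩, hxy, h.mem_insert hy hxy.symm.adj, Or.inr hy⟩

theorem exists_isLink (h : IsEndPiece G X c) : ∃ e, ∃ x ∈ X, (endBlock G X c).IsLink e c x := by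
  have : c ∈ boundary G X := by rw [h.boundary_eq]; rfl
  obtain ⟨-, x, hx, e, he⟩ := mem_boundary.1 this
  exact ⟨e, x, hx, h.isLink_endBlock.2 ⟨he, Or.inr hx⟩⟩

theorem endBlock_le (h : IsEndPiece G X c) (hV : V(G) = Set.univ) : endBlock G X c ≤ G :=
  ⟨hV ▸ Set.subset_univ _, fun _ _ _ hl => (h.isLink_endBlock.1 hl).1⟩

theorem endBlock_isConnected (h : IsEndPiece G X c) (hG : IsConnected G) (hV : V(G) = Set.univ) :
    IsConnected (endBlock G X c) := by
  have key : ∀ x ∈ insert c X, Relation.ReflTransGen (endBlock G X c).Adj x c := by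
    set R := {x | x ∈ X ∧ ¬ Relation.ReflTransGen (endBlock G X c).Adj x c} with hR
    have hRe : ¬ R.Nonempty := by
      intro hne
      obtain ⟨z, hz⟩ := hG.boundary_nonempty hV hne (z := c) (fun hc => h.notMem hc.1)
      obtain ⟨hzR, x, hx, hzx⟩ := mem_boundary.1 hz
      have hzc : Relation.ReflTransGen (endBlock G X c).Adj z c := by
        rcases h.mem_insert hx.1 hzx.symm with rfl | hzX
        · exact Relation.ReflTransGen.refl
        · by_contra hcon
          exact hzR ⟨hzX, hcon⟩
      obtain ⟨e, he⟩ := hzx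
      exact hx.2 (Relation.ReflTransGen.head ⟨e, h.isLink_endBlock.2 ⟨he.symm, Or.inl hx.1⟩⟩ hzc)
    rintro x (rfl | hx)
    · exact Relation.ReflTransGen.refl
    · by_contra hcon
      exact hRe ⟨x, hx, hcon⟩
  refine ⟨⟨c, Or.inl rfl⟩, fun x hx y hy => (key x hx).trans ?_⟩
  have hs : Std.Symm (Relation.ReflTransGen (endBlock G X c).Adj) := inferInstance
  exact hs.symm _ _ (key y hy)

/-- The arcs that meet `X` and those that avoid it form the two parts, which share only `c`. -/
theorem isSeparatingNode_of_le (h : IsEndPiece G X c) (hKG : K ≤ G) (hHK : endBlock G X c ≤ K)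
    (hex : ∃ e x y, K.IsLink e x y ∧ x ∉ X ∧ y ∉ X) : IsSeparatingNode K c := by
  refine ⟨endBlock G X c, K.deleteVerts X, hHK, Graph.deleteVerts_le, ?_, ?_, ?_, ?_, ?_⟩
  · obtain ⟨e, x, -, he⟩ := h.exists_isLink
    exact ⟨e, he.edge_mem⟩
  · obtain ⟨e, x, y, he, hx, hy⟩ := hex
    exact ⟨e, Graph.IsLink.edge_mem (x := x) (y := y) (by simp [he, hx, hy])⟩
  · refine Set.Subset.antisymm (Set.union_subset (Graph.IsSubgraph.edgeSet_mono hHK)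
      (Graph.IsSubgraph.edgeSet_mono Graph.deleteVerts_le)) fun e he => ?_
    obtain ⟨x, y, hxy⟩ := Graph.exists_isLink_of_mem_edgeSet he
    by_cases hX : x ∈ X ∨ y ∈ X
    · exact Or.inl (h.isLink_endBlock.2 ⟨hxy.mono hKG, hX⟩).edge_mem
    · push Not at hX
      exact Or.inr (Graph.IsLink.edge_mem (x := x) (y := y) (by simp [hxy, hX]))
  · rw [Set.disjoint_left]
    intro e he he'
    obtain ⟨x, y, hxy⟩ := Graph.exists_isLink_of_mem_edgeSet he
    obtain ⟨a, b, hab⟩ := Graph.exists_isLink_of_mem_edgeSet he'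
    rw [Graph.deleteVerts_isLink] at hab
    obtain ⟨hxy, hX⟩ := h.isLink_endBlock.1 hxy
    rcases (hab.1.mono hKG).eq_and_eq_or_eq_and_eq hxy with ⟨rfl, rfl⟩ | ⟨rfl, rfl⟩ <;> tauto
  · have hcV : c ∈ V(K) := hHK.1 (Or.inl rfl)
    ext x
    simp only [vertexSet_endBlock, Graph.vertexSet_deleteVerts, Set.mem_inter_iff,
      Set.mem_insert_iff, Set.mem_sdiff, Set.mem_singleton_iff]
    have := h.notMem
    constructor
    · tauto
    · rintro rfl
      tauto

theorem isSeparatingNode (h : IsEndPiece G X c) (hV : V(G) = Set.univ) : IsSeparatingNode G c :=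
  h.isSeparatingNode_of_le le_rfl (h.endBlock_le hV) h.avoided

end IsEndPiece

/-- In a decomposition of `K` at `w`, the arcs at a node of the first part other than `w` belong to
the first part. -/
theorem isLink_left_of_decomposition {K₁ K₂ : Graph α β} (h1 : K₁ ≤ K) (h2 : K₂ ≤ K)
    (hE : E(K₁) ∪ E(K₂) = E(K)) (hw : V(K₁) ∩ V(K₂) = {w}) (hx : x ∈ V(K₁)) (hxw : x ≠ w)
    (he : K.IsLink e x y) : K₁.IsLink e x y := by
  have : e ∈ E(K₁) ∪ E(K₂) := hE ▸ he.edge_mem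
  rcases this with h | h
  · exact (h1.isLink_iff h).2 he
  · exfalso
    have hx2 : x ∈ V(K₂) := ((h2.isLink_iff h).2 he).left_mem
    have : x ∈ V(K₁) ∩ V(K₂) := ⟨hx, hx2⟩
    rw [hw] at this
    exact hxw this

namespace IsEndPiece

theorem boundary_part_subset (h : IsEndPiece G X c) (hK : ∀ e x y, x ∈ X → G.IsLink e x y →
    K.IsLink e x y) {K₁ K₂ : Graph α β} (h1 : K₁ ≤ K) (h2 : K₂ ≤ K) (hE : E(K₁) ∪ E(K₂) = E(K))
    (hw : V(K₁) ∩ V(K₂) = {w}) (hc : c ∉ V(K₁) ∨ w = c) :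
    boundary G ((V(K₁) \ {w}) ∩ X) ⊆ {w} := by
  intro z hz
  obtain ⟨hz, y, ⟨⟨hy1, hyw⟩, hyX⟩, e, he⟩ := mem_boundary.1 hz
  by_contra hzw
  have hl := isLink_left_of_decomposition h1 h2 hE hw hy1 hyw (hK e y z hyX he.symm)
  rcases h.mem_insert hyX he.symm.adj with rfl | hzX
  · rcases hc with hc | rfl
    · exact hc hl.right_mem
    · exact hzw rfl
  · exact hz ⟨⟨hl.right_mem, hzw⟩, hzX⟩

/-- The nodes of `X` in the part without `c`, with `w` removed, have no outer neighbour but `w`. As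
this set misses `w ∈ X`, minimality makes it empty. The part still has a node other than `w`, since
`w` has no loop, but such a node could then not reach `w`. -/
theorem false_of_decomposition_at_mem (h : IsEndPiece G X c) (hKG : K ≤ G) (hKc : IsConnected K)
    (hK : ∀ e x y, x ∈ X → G.IsLink e x y → K.IsLink e x y) {K₁ K₂ : Graph α β} (h1 : K₁ ≤ K)
    (h2 : K₂ ≤ K) (hE1 : E(K₁).Nonempty) (hE : E(K₁) ∪ E(K₂) = E(K))
    (hw : V(K₁) ∩ V(K₂) = {w}) (hwX : w ∈ X) (hc : c ∉ V(K₁)) : False := by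
  have hsub := h.boundary_part_subset hK h1 h2 hE hw (Or.inl hc)
  have hY : ¬ ((V(K₁) \ {w}) ∩ X).Nonempty := by
    intro hne
    have := h.minimal _ Set.inter_subset_right hne (Set.subsingleton_singleton.anti hsub)
    rw [← this] at hwX
    exact hwX.1.2 rfl
  have hwK : w ∈ V(K₁) ∩ V(K₂) := hw ▸ rfl
  obtain ⟨a, ha, haw⟩ : ∃ a ∈ V(K₁), a ≠ w := by
    obtain ⟨e, he⟩ := hE1
    obtain ⟨a, b, hab⟩ := Graph.exists_isLink_of_mem_edgeSet he
    by_cases haw : a = w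
    · subst haw
      refine ⟨b, hab.right_mem, ?_⟩
      rintro rfl
      exact h.loopless _ hwX e (hab.mono (h1.trans hKG))
    · exact ⟨a, hab.left_mem, haw⟩
  have key : ∀ b, Relation.ReflTransGen K.Adj a b → b ∈ V(K₁) ∧ b ≠ w := by
    intro b hb
    induction hb with
    | refl => exact ⟨ha, haw⟩
    | tail _ hab ih =>
      obtain ⟨e, he⟩ := hab
      have hl := isLink_left_of_decomposition h1 h2 hE hw ih.1 ih.2 he
      refine ⟨hl.right_mem, ?_⟩
      rintro rfl
      rcases h.mem_insert hwX (he.mono hKG).symm.adj with rfl | hX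
      · exact hc hl.left_mem
      · exact hY ⟨_, ⟨ih.1, ih.2⟩, hX⟩
  exact (key w (hKc.2 a (h1.1 ha) w (h1.1 hwK.1))).2 rfl

theorem not_isSeparatingNode_of_mem (h : IsEndPiece G X c) (hKG : K ≤ G) (hKc : IsConnected K)
    (hK : ∀ e x y, x ∈ X → G.IsLink e x y → K.IsLink e x y) (hwX : w ∈ X) :
    ¬ IsSeparatingNode K w := by
  rintro ⟨K₁, K₂, h1, h2, hE1, hE2, hE, -, hw⟩
  by_cases hc : c ∈ V(K₁)
  · have hc2 : c ∉ V(K₂) := by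
      intro hc2
      have : c ∈ V(K₁) ∩ V(K₂) := ⟨hc, hc2⟩
      rw [hw] at this
      exact h.notMem (this ▸ hwX)
    exact h.false_of_decomposition_at_mem hKG hKc hK h2 h1 hE2 (by rwa [Set.union_comm])
      (by rwa [Set.inter_comm]) hwX hc2
  · exact h.false_of_decomposition_at_mem hKG hKc hK h1 h2 hE1 hE hw hwX hc

/-- Every arc of the end block meets `X`, so the part contains a node of `X`, and minimality forces
all of `X` into it. Applied to both parts, this rules out a decomposition at `c`. -/
theorem subset_of_decomposition_at_boundary (h : IsEndPiece G X c)
    {K₁ K₂ : Graph α β} (h1 : K₁ ≤ endBlock G X c) (h2 : K₂ ≤ endBlock G X c)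
    (hE1 : E(K₁).Nonempty) (hE : E(K₁) ∪ E(K₂) = E(endBlock G X c))
    (hw : V(K₁) ∩ V(K₂) = {c}) : X ⊆ V(K₁) := by
  have hsub := h.boundary_part_subset (K := endBlock G X c)
    (fun e x y hx he => h.isLink_endBlock.2 ⟨he, Or.inl hx⟩) h1 h2 hE hw (Or.inr rfl)
  have hne : ((V(K₁) \ {c}) ∩ X).Nonempty := by
    obtain ⟨e, he⟩ := hE1
    obtain ⟨a, b, hab⟩ := Graph.exists_isLink_of_mem_edgeSet he
    have hc := h.notMem
    rcases (h.isLink_endBlock.1 (hab.mono h1)).2 with ha | hb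
    · exact ⟨a, ⟨hab.left_mem, fun h => hc (h ▸ ha)⟩, ha⟩
    · exact ⟨b, ⟨hab.right_mem, fun h => hc (h ▸ hb)⟩, hb⟩
  have := h.minimal _ Set.inter_subset_right hne (Set.subsingleton_singleton.anti hsub)
  intro x hx
  rw [← this] at hx
  exact hx.1.1

theorem endBlock_isNonseparable (h : IsEndPiece G X c) (hG : IsConnected G)
    (hV : V(G) = Set.univ) : IsNonseparable (endBlock G X c) := by
  have hcon := h.endBlock_isConnected hG hV
  refine ⟨hcon, fun w hsep => ?_⟩
  have hsep' := hsep
  obtain ⟨K₁, K₂, h1, h2, hE1, hE2, hE, -, hw⟩ := hsep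
  have hwK : w ∈ V(K₁) ∩ V(K₂) := hw ▸ rfl
  rcases h1.1 hwK.1 with rfl | hwX
  · have s1 := h.subset_of_decomposition_at_boundary h1 h2 hE1 hE hw
    have s2 := h.subset_of_decomposition_at_boundary h2 h1 hE2 (by rwa [Set.union_comm])
      (by rwa [Set.inter_comm])
    obtain ⟨x, hx⟩ := h.nonempty
    have : x ∈ V(K₁) ∩ V(K₂) := ⟨s1 hx, s2 hx⟩
    rw [hw] at this
    exact h.notMem (this ▸ hx)
  · exact h.not_isSeparatingNode_of_mem (h.endBlock_le hV) hcon
      (fun e x y hx he => h.isLink_endBlock.2 ⟨he, Or.inl hx⟩) hwX hsep'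

/-- A larger non-separable subgraph has no arc avoiding `X`, as `c` would then separate it; so it
gains no arcs and, being connected, no nodes. -/
theorem endBlock_isNonseparableComponent (h : IsEndPiece G X c) (hG : IsConnected G)
    (hV : V(G) = Set.univ) : IsNonseparableComponent G (endBlock G X c) := by
  refine ⟨⟨h.endBlock_le hV, h.endBlock_isNonseparable hG hV⟩, ?_⟩
  rintro K ⟨hKG, hK⟩ hHK
  have hmeet : ∀ e x y, K.IsLink e x y → x ∈ X ∨ y ∈ X := by
    intro e x y he
    by_contra! hcon
    exact hK.2 c (h.isSeparatingNode_of_le hKG hHK ⟨e, x, y, he, hcon⟩)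
  have hl : ∀ e x y, K.IsLink e x y → (endBlock G X c).IsLink e x y := fun e x y he =>
    h.isLink_endBlock.2 ⟨he.mono hKG, hmeet e x y he⟩
  refine ⟨fun x hx => ?_, fun e x y he => hl e x y he⟩
  obtain ⟨e, z, -, he⟩ := h.exists_isLink
  obtain ⟨y, f, hf⟩ := hK.1.exists_adj ⟨e, (he.mono hHK).edge_mem⟩ hx
  exact (hl _ _ _ hf).left_mem

theorem eq_of_isSeparatingNode (h : IsEndPiece G X c) (hG : IsConnected G)
    (hw : w ∈ V(endBlock G X c)) (hsep : IsSeparatingNode G w) : w = c := by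
  rcases hw with rfl | hw
  · rfl
  · exact (h.not_isSeparatingNode_of_mem le_rfl hG (fun _ _ _ _ he => he) hw hsep).elim

theorem eq_of_endBlock_eq {X' : Set α} {c' : α} (h : IsEndPiece G X c) (h' : IsEndPiece G X' c')
    (hG : IsConnected G) (hV : V(G) = Set.univ) (heq : endBlock G X c = endBlock G X' c') :
    X = X' := by
  have hc : c' = c := h.eq_of_isSeparatingNode hG (heq ▸ Or.inl rfl) (h'.isSeparatingNode hV)
  subst hc
  have : insert c' X = insert c' X' := congrArg Graph.vertexSet heq
  rw [← Set.insert_sdiff_self_of_notMem h.notMem, this, Set.insert_sdiff_self_of_notMem h'.notMem]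

end IsEndPiece

/-! ### Loops -/

theorem isLink_loop {f : β} : (Graph.bouquet w {e} : Graph α β).IsLink f x y ↔
    f = e ∧ x = w ∧ y = w := by
  simp

theorem bouquet_le (he : K.IsLink e w w) : Graph.bouquet w {e} ≤ K := by
  refine ⟨?_, ?_⟩
  · rw [Graph.vertexSet_bouquet]
    exact Set.singleton_subset_iff.2 he.left_mem
  · intro f x y hf
    obtain ⟨rfl, rfl, rfl⟩ := isLink_loop.1 hf
    exact he

theorem isSeparatingNode_of_loop (he : K.IsLink e w w) {f : β} (hf : f ∈ E(K)) (hfe : f ≠ e) :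
    IsSeparatingNode K w := by
  refine ⟨Graph.bouquet w {e}, K.restrict {e}ᶜ, bouquet_le he, Graph.restrict_le,
    ⟨e, Graph.IsLink.edge_mem (isLink_loop.2 ⟨rfl, rfl, rfl⟩)⟩, ⟨f, hf, hfe⟩, ?_, ?_, ?_⟩
  · ext g
    have := he.edge_mem
    by_cases hg : g = e <;> simp [hg, this]
  · rw [Set.disjoint_left]
    rintro g hg hg'
    simp at hg hg'
    exact hg'.2 hg
  · ext x
    simp only [Graph.vertexSet_bouquet, Graph.vertexSet_restrict, Set.mem_inter_iff,
      Set.mem_singleton_iff, and_iff_left_iff_imp]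
    rintro rfl
    exact he.left_mem

theorem bouquet_isNonseparableComponent (he : G.IsLink e w w) :
    IsNonseparableComponent G (Graph.bouquet w {e}) := by
  refine ⟨⟨bouquet_le he, ⟨⟨w, by simp⟩, ?_⟩, ?_⟩, ?_⟩
  · intro x hx y hy
    simp at hx hy
    subst hx hy
    exact Relation.ReflTransGen.refl
  · rintro z ⟨K₁, K₂, h1, h2, ⟨f, hf⟩, ⟨g, hg⟩, -, hd, -⟩
    have hf' := Graph.IsSubgraph.edgeSet_mono h1 hf
    have hg' := Graph.IsSubgraph.edgeSet_mono h2 hg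
    simp at hf' hg'
    subst hf' hg'
    exact Set.disjoint_left.1 hd hf hg
  · rintro K ⟨hKG, hK⟩ hle
    have heK : K.IsLink e w w := (isLink_loop.2 ⟨rfl, rfl, rfl⟩ :
      (Graph.bouquet w {e} : Graph α β).IsLink e w w).mono hle
    have hl : ∀ f x y, K.IsLink f x y → (Graph.bouquet w {e} : Graph α β).IsLink f x y := by
      intro f x y hf
      have hfe : f = e := by
        by_contra hfe
        exact hK.2 w (isSeparatingNode_of_loop heK hf.edge_mem hfe)
      subst hfe
      rw [isLink_loop]
      rcases hf.eq_and_eq_or_eq_and_eq heK with h | h <;> tauto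
    refine ⟨fun x hx => ?_, fun f x y hf => hl f x y hf⟩
    obtain ⟨y, f, hf⟩ := hK.1.exists_adj ⟨e, heK.edge_mem⟩ hx
    exact (hl _ _ _ hf).left_mem

/-! ### Counting leaves -/

instance [Finite α] [Finite β] : Finite (Graph α β) := by
  refine Finite.of_injective
    (fun G : Graph α β => (⟨V(G), {p | G.IsLink p.1 p.2.1 p.2.2}⟩ : Set α × Set (β × α × α))) ?_
  intro G H h
  simp only [Prod.mk.injEq] at h
  refine Graph.ext h.1 fun e x y => ?_
  have := Set.ext_iff.1 h.2 (e, x, y)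
  simpa using this

/-- A component with exactly one separating node has exactly one neighbour in the block-separating
tree. -/
theorem card_le_numLeaves [Finite α] [Finite β] {ι : Type*} (g : ι → Graph α β)
    (hg : Function.Injective g) (hcomp : ∀ i, IsNonseparableComponent G (g i))
    (hsep : ∀ i, ∃ w ∈ V(g i), IsSeparatingNode G w ∧
      ∀ w' ∈ V(g i), IsSeparatingNode G w' → w' = w) :
    Nat.card ι ≤ numLeaves G := by
  classical
  unfold numLeaves
  rw [← Nat.card_coe_set_eq]
  refine Nat.card_le_card_of_injective
    (fun i => ⟨Sum.inr ⟨g i, hcomp i⟩, ?_⟩) ?_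
  · obtain ⟨w, hw, hws, huniq⟩ := hsep i
    rw [Set.mem_ofPred_eq, Set.ncard_eq_one]
    refine ⟨Sum.inl ⟨w, hws⟩, ?_⟩
    ext x
    simp only [SimpleGraph.mem_neighborSet, blockSeparatingTree, SimpleGraph.fromRel_adj,
      Set.mem_singleton_iff]
    constructor
    · rintro ⟨-, ⟨w', H, h, -, -⟩ | ⟨w', H, rfl, h, hm⟩⟩
      · simp at h
      · obtain rfl := Sum.inr_injective h
        have := huniq w'.1 hm w'.2
        exact congrArg Sum.inl (Subtype.ext this)
    · rintro rfl
      exact ⟨by simp, Or.inr ⟨_, _, rfl, rfl, hw⟩⟩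
  · intro i j hij
    simp only [Subtype.mk.injEq, Sum.inr.injEq] at hij
    exact hg hij

theorem IsConnected.exists_ne_edge [Nontrivial α] (hG : IsConnected G) (hV : V(G) = Set.univ)
    (he : G.IsLink e w w) : ∃ f ∈ E(G), f ≠ e := by
  obtain ⟨z, hz⟩ := exists_ne w
  obtain ⟨y, hy⟩ := hG.boundary_nonempty hV (Set.singleton_nonempty w) (z := z) hz
  obtain ⟨hyw, x, rfl, f, hf⟩ := mem_boundary.1 hy
  refine ⟨f, hf.edge_mem, ?_⟩
  rintro rfl
  rcases hf.eq_and_eq_or_eq_and_eq he with h | h <;> exact hyw h.1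

theorem ncard_add_ncard_le_numLeaves [Finite α] [Finite β] [Nontrivial α] (hG : IsConnected G)
    (hV : V(G) = Set.univ) (M : Set (Set α)) (hM : ∀ X ∈ M, ∃ c, IsEndPiece G X c) :
    M.ncard + {e | ∃ w, G.IsLink e w w}.ncard ≤ numLeaves G := by
  choose! c hc using hM
  set L := {e | ∃ w, G.IsLink e w w} with hL
  have : ∀ e : L, ∃ w, G.IsLink e w w := fun e => e.2
  choose l hl using this
  have := card_le_numLeaves (G := G) (ι := M ⊕ L)
    (Sum.elim (fun X => endBlock G X.1 (c X.1)) fun e => Graph.bouquet (l e) {e.1}) ?_ ?_ ?_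
  · simpa using this
  · have hne : ∀ (X : M) (e : L), endBlock G X.1 (c X.1) ≠ Graph.bouquet (l e) {e.1} := by
      intro X e heq
      obtain ⟨f, x, hx, hf⟩ := (hc X X.2).exists_isLink
      rw [heq, isLink_loop] at hf
      exact (hc X X.2).notMem (hf.2.1.trans hf.2.2.symm ▸ hx)
    rintro (X | e) (X' | e') heq
    · exact congrArg Sum.inl
        (Subtype.ext ((hc X X.2).eq_of_endBlock_eq (hc X' X'.2) hG hV heq))
    · exact (hne _ _ heq).elim
    · exact (hne _ _ heq.symm).elim
    · have : ({e.1} : Set β) = {e'.1} := by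
        have := congrArg Graph.edgeSet heq
        simpa using this
      exact congrArg Sum.inr (Subtype.ext (Set.singleton_injective this))
  · rintro (X | e)
    · exact (hc X X.2).endBlock_isNonseparableComponent hG hV
    · exact bouquet_isNonseparableComponent (hl e)
  · rintro (X | e)
    · exact ⟨c X, Or.inl rfl, (hc X X.2).isSeparatingNode hV, fun w' hw' hs =>
        (hc X X.2).eq_of_isSeparatingNode hG hw' hs⟩
    · obtain ⟨f, hf, hfe⟩ := hG.exists_ne_edge hV (hl e)
      refine ⟨l e, by simp, isSeparatingNode_of_loop (hl e) hf hfe, fun w' hw' _ => ?_⟩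
      simpa using hw'

end BranchGraph

/-! ### Choosing the root and bounding sinks by the branching number. -/

namespace BranchGraph

variable {α : Type u} {β : Type v} {G K : Graph α β} {X Y : Set α} {c w r x y z : α} {e : β}

/-- A node set that avoids `r` and has at most one outer neighbour. -/
def IsRootedPiece (G : Graph α β) (r : α) (X : Set α) : Prop :=
  X.Nonempty ∧ r ∉ X ∧ (boundary G X).Subsingleton

/-- The minimal node sets without loops that avoid `r` and have at most one outer neighbour. -/
def rootedEnds (G : Graph α β) (r : α) : Set (Set α) :=
  {X | Minimal (IsRootedPiece G r) X ∧ ∀ x ∈ X, ∀ e, ¬ G.IsLink e x x}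

/-- The nodes without loops that have no neighbour of larger height. -/
def sinks (G : Graph α β) (r : α) (h : α → ℕ) : Set α :=
  {v | v ≠ r ∧ (∀ e, ¬ G.IsLink e v v) ∧ ∀ u, G.Adj v u → h u ≤ h v}

/-- One representative is allowed as a sink in each minimal rooted piece. A piece with a loop is
represented by a node with a loop, so only loopless pieces contribute to `sinks`. -/
theorem exists_order_sinks_le [Finite α] (hG : IsConnected G) (hV : V(G) = Set.univ) (r : α) :
    ∃ h : α → ℕ, Function.Injective h ∧ (∀ v, v ≠ r → ∃ u, G.Adj u v ∧ h u < h v) ∧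
      (sinks G r h).ncard ≤ (rootedEnds G r).ncard := by
  have hτ : ∀ X : Set α, X.Nonempty → ∃ t ∈ X, (∃ x ∈ X, ∃ e, G.IsLink e x x) →
      ∃ e, G.IsLink e t t := by
    intro X hX
    by_cases hl : ∃ x ∈ X, ∃ e, G.IsLink e x x
    · obtain ⟨x, hx, he⟩ := hl
      exact ⟨x, hx, fun _ => he⟩
    · obtain ⟨x, hx⟩ := hX
      exact ⟨x, hx, fun h => (hl h).elim⟩
  have : Nonempty α := ⟨r⟩
  choose! τ hτX hτl using hτ
  obtain ⟨h, hinj, hdown, hup⟩ := (underlying G).exists_order_of_sinks r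
    (τ '' {X | Minimal (IsRootedPiece G r) X})
    (fun X hX hr => hG.boundary_nonempty hV hX hr) (by
      intro X hX hr hs
      obtain ⟨Y, hYX, hY⟩ := exists_minimal_le_of_wellFoundedLT (IsRootedPiece G r) X ⟨hX, hr, hs⟩
      exact ⟨τ Y, hYX (hτX Y hY.1.1), Y, hY, rfl⟩)
  refine ⟨h, hinj, fun v hv => ?_, ?_⟩
  · obtain ⟨u, hu, hlt⟩ := hdown v hv
    exact ⟨u, hu.2, hlt⟩
  · refine (Set.ncard_le_ncard (t := τ '' rootedEnds G r) ?_ (Set.toFinite _)).trans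
      (Set.ncard_image_le (Set.toFinite _))
    rintro v ⟨hvr, hvl, hvs⟩
    by_cases hvT : v ∈ τ '' {X | Minimal (IsRootedPiece G r) X}
    · obtain ⟨X, hX, rfl⟩ := hvT
      refine ⟨X, ⟨hX, fun x hx e he => ?_⟩, rfl⟩
      obtain ⟨f, hf⟩ := hτl X hX.1.1 ⟨x, hx, e, he⟩
      exact hvl f hf
    · obtain ⟨u, hu, hlt⟩ := hup v hvr hvT
      exact absurd (hvs u hu.2) (not_le.2 hlt)

theorem isEndPiece_of_mem_rootedEnds (hG : IsConnected G) (hV : V(G) = Set.univ)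
    (hX : X ∈ rootedEnds G r) (hex : ∃ e x y, G.IsLink e x y ∧ x ∉ X ∧ y ∉ X) :
    ∃ c, IsEndPiece G X c := by
  obtain ⟨⟨⟨hne, hr, hs⟩, hmin⟩, hl⟩ := hX
  obtain ⟨c, hc⟩ := hG.boundary_nonempty hV hne hr
  refine ⟨c, hne, Set.Subset.antisymm (fun y hy => hs hy hc) (Set.singleton_subset_iff.2 hc), hl,
    fun Y hYX hY hYs => ?_, hex⟩
  exact hYX.antisymm (hmin ⟨hY, fun h => hr (hYX h), hYs⟩ hYX)

/-- If every arc meets `X`, each node outside `X` is an outer neighbour of `X`; there is at most one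
of these, and `r` is outside. -/
theorem eq_compl_of_mem_rootedEnds [Nontrivial α] (hG : IsConnected G) (hV : V(G) = Set.univ)
    (hX : X ∈ rootedEnds G r) (hex : ¬ ∃ e x y, G.IsLink e x y ∧ x ∉ X ∧ y ∉ X) :
    X = {r}ᶜ := by
  obtain ⟨⟨⟨-, hr, hs⟩, -⟩, -⟩ := hX
  have key : ∀ z ∉ X, z ∈ boundary G X := by
    intro z hz
    obtain ⟨y, hy⟩ := exists_ne z
    obtain ⟨u, hu⟩ := hG.boundary_nonempty hV (Set.singleton_nonempty z) (z := y) hy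
    obtain ⟨-, x, rfl, e, he⟩ := mem_boundary.1 hu
    by_cases huX : u ∈ X
    · exact mem_boundary.2 ⟨hz, u, huX, e, he.symm⟩
    · exact (hex ⟨e, u, x, he, huX, hz⟩).elim
  ext z
  constructor
  · rintro hz rfl
    exact hr hz
  · intro hz
    by_contra hzX
    exact hz (hs (key z hzX) (key r hr))

/-- A separable connected graph without loops has an end piece. -/
theorem exists_isEndPiece_of_isSeparatingNode [Finite α] (hG : IsConnected G)
    (hV : V(G) = Set.univ) (hl : ∀ e x, ¬ G.IsLink e x x) (hw : IsSeparatingNode G w) :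
    ∃ X c, IsEndPiece G X c := by
  let P : Set α → Prop := fun X => X.Nonempty ∧ (boundary G X).Subsingleton ∧
    ∃ e x y, G.IsLink e x y ∧ x ∉ X ∧ y ∉ X
  obtain ⟨G₁, G₂, h1, h2, ⟨e, he⟩, ⟨f, hf⟩, hE, -, hw⟩ := hw
  have hP : P (V(G₁) \ {w}) := by
    refine ⟨?_, ?_, ?_⟩
    · obtain ⟨x, y, hxy⟩ := Graph.exists_isLink_of_mem_edgeSet he
      by_cases hx : x = w
      · refine ⟨y, hxy.right_mem, ?_⟩
        rintro rfl
        subst hx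
        exact hl _ _ (hxy.mono h1)
      · exact ⟨x, hxy.left_mem, hx⟩
    · refine (Set.subsingleton_singleton (a := w)).anti ?_
      intro z hz
      obtain ⟨hz, y, ⟨hy, hyw⟩, g, hg⟩ := mem_boundary.1 hz
      by_contra hzw
      exact hz ⟨(isLink_left_of_decomposition h1 h2 hE hw hy hyw hg.symm).right_mem, hzw⟩
    · obtain ⟨x, y, hxy⟩ := Graph.exists_isLink_of_mem_edgeSet hf
      have key : ∀ z ∈ V(G₂), z ∉ V(G₁) \ {w} := by
        rintro z hz ⟨hz1, hzw⟩
        have : z ∈ V(G₁) ∩ V(G₂) := ⟨hz1, hz⟩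
        rw [hw] at this
        exact hzw this
      exact ⟨f, x, y, hxy.mono h2, key x hxy.left_mem, key y hxy.right_mem⟩
  -- Being avoided by an arc passes to subsets, so a minimal `X` is also minimal for the boundary
  -- condition alone.
  obtain ⟨X, -, ⟨hne, hs, hex⟩, hmin⟩ := exists_minimal_le_of_wellFoundedLT P _ hP
  obtain ⟨z, hz⟩ : ∃ z, z ∉ X := by
    obtain ⟨e, x, -, -, hx, -⟩ := hex
    exact ⟨x, hx⟩
  obtain ⟨c, hc⟩ := hG.boundary_nonempty hV hne hz
  refine ⟨X, c, hne, Set.Subset.antisymm (fun y hy => hs hy hc) (Set.singleton_subset_iff.2 hc),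
    fun x _ e => hl e x, fun Y hYX hY hYs => hYX.antisymm (hmin ⟨hY, hYs, ?_⟩ hYX), hex⟩
  obtain ⟨e, x, y, he, hx, hy⟩ := hex
  exact ⟨e, x, y, he, fun h => hx (hYX h), fun h => hy (hYX h)⟩

theorem branch_of_isNonseparable [Finite α] [Nontrivial α] (hV : V(G) = Set.univ)
    (h : IsNonseparable G) : branch G = 2 := by
  have : 1 < V(G).ncard := by
    rw [hV, Set.ncard_univ]
    exact Finite.one_lt_card
  unfold branch
  rw [if_neg (by omega), if_pos ⟨h, this⟩]

theorem branch_of_not_isNonseparable (h : ¬ IsNonseparable G) : branch G = numLeaves G := by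
  simp [branch, h]

/-- The nodes of a connected graph can be ordered in such a way that there is a single source `r` and
the numbers of loops and of sinks without loops are bounded by the branching number. -/
theorem exists_order_le_branch [Finite α] [Finite β] [Nontrivial α] (hG : IsConnected G)
    (hV : V(G) = Set.univ) :
    ∃ (r : α) (h : α → ℕ), Function.Injective h ∧ (∀ v, v ≠ r → ∃ u, G.Adj u v ∧ h u < h v) ∧
      ((sinks G r h).ncard + {e | ∃ w, G.IsLink e w w}.ncard + 1 ≤ branch G ∨
        (∃ e, G.IsLink e r r) ∧
          (sinks G r h).ncard + {e | ∃ w, G.IsLink e w w}.ncard ≤ branch G) := by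
  by_cases hloop : ∃ r e, G.IsLink e r r
  · obtain ⟨r, e, he⟩ := hloop
    obtain ⟨h, hinj, hdown, hs⟩ := exists_order_sinks_le hG hV r
    refine ⟨r, h, hinj, hdown, Or.inr ⟨⟨e, he⟩, ?_⟩⟩
    obtain ⟨f, hf, hfe⟩ := hG.exists_ne_edge hV he
    rw [branch_of_not_isNonseparable fun hns => hns.2 r (isSeparatingNode_of_loop he hf hfe)]
    -- The loop at `r` is an arc avoiding every rooted end.
    have := ncard_add_ncard_le_numLeaves hG hV (rootedEnds G r) fun X hX =>
      isEndPiece_of_mem_rootedEnds hG hV hX ⟨e, r, r, he, hX.1.1.2.1, hX.1.1.2.1⟩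
    omega
  · have hl : ∀ e x, ¬ G.IsLink e x x := fun e x he => hloop ⟨x, e, he⟩
    have hL : {e | ∃ w, G.IsLink e w w} = (∅ : Set β) := by
      ext e; simpa using hl e
    rw [hL, Set.ncard_empty]
    by_cases hns : IsNonseparable G
    · obtain ⟨r⟩ : Nonempty α := inferInstance
      obtain ⟨h, hinj, hdown, hs⟩ := exists_order_sinks_le hG hV r
      refine ⟨r, h, hinj, hdown, Or.inl ?_⟩
      rw [branch_of_isNonseparable hV hns]
      have : (rootedEnds G r).ncard ≤ ({{r}ᶜ} : Set (Set α)).ncard := by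
        refine Set.ncard_le_ncard (fun X hX => ?_) (Set.toFinite _)
        refine eq_compl_of_mem_rootedEnds hG hV hX fun hex => ?_
        obtain ⟨c, hc⟩ := isEndPiece_of_mem_rootedEnds hG hV hX hex
        exact hns.2 c (hc.isSeparatingNode hV)
      rw [Set.ncard_singleton] at this
      omega
    · obtain ⟨w, hw⟩ : ∃ w, IsSeparatingNode G w := by
        by_contra! hcon
        exact hns ⟨hG, hcon⟩
      obtain ⟨X₀, c₀, h₀⟩ := exists_isEndPiece_of_isSeparatingNode hG hV hl hw
      -- Rooting inside `X₀` keeps `X₀` from being a rooted end, so it counts as one extra leaf.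
      obtain ⟨r, hr⟩ := h₀.nonempty
      obtain ⟨h, hinj, hdown, hs⟩ := exists_order_sinks_le hG hV r
      refine ⟨r, h, hinj, hdown, Or.inl ?_⟩
      rw [branch_of_not_isNonseparable hns]
      have hX₀ : X₀ ∉ rootedEnds G r := fun hX => hX.1.1.2.1 hr
      have := ncard_add_ncard_le_numLeaves hG hV (insert X₀ (rootedEnds G r)) ?_
      · rw [Set.ncard_insert_of_notMem hX₀ (Set.toFinite _), hL, Set.ncard_empty] at this
        omega
      · rintro X (rfl | hX)
        · exact ⟨c₀, h₀⟩
        · refine isEndPiece_of_mem_rootedEnds hG hV hX ?_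
          by_contra hex
          have hXr := eq_compl_of_mem_rootedEnds hG hV hX hex
          have hcr : c₀ ≠ r := fun h => h₀.notMem (h ▸ hr)
          -- This rooted piece lies in `X = {r}ᶜ` and misses `c₀ ∈ X`, against the minimality of
          -- `X`.
          have hY : IsRootedPiece G r (insert c₀ X₀)ᶜ := by
            refine ⟨?_, fun h => h (Or.inr hr), ?_⟩
            · obtain ⟨e, x, y, he, hx, hy⟩ := h₀.avoided
              by_cases hxc : x = c₀
              · refine ⟨y, ?_⟩
                rintro (rfl | hy')
                · exact hl e x (hxc ▸ he)
                · exact hy hy'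
              · refine ⟨x, ?_⟩
                rintro (h | h)
                · exact hxc h
                · exact hx h
            · refine (Set.subsingleton_singleton (a := c₀)).anti fun z hz => ?_
              obtain ⟨hz, y, hy, hzy⟩ := mem_boundary.1 hz
              rw [Set.notMem_compl_iff] at hz
              rcases hz with hz | hz
              · exact hz
              · exact (hy (h₀.mem_insert hz hzy)).elim
          have hsub : (insert c₀ X₀)ᶜ ⊆ X := by
            rw [hXr, Set.compl_subset_compl]
            rintro _ rfl
            exact Or.inr hr
          have hc : c₀ ∈ X := by rw [hXr]; exact hcr
          exact hX.1.2 hY hsub hc (Or.inl rfl)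

end BranchGraph

/-! ### Counting vertices and facets of the triangulation. -/

namespace GenTriangulation

variable {d : ℕ} {T : GenTriangulation.{u, v} d}

/-! ### Connectedness of the dual graph -/

theorem dualGraph_isLink {e : T.Gluing} {σ τ : T.Simplex} :
    T.dualGraph.IsLink e σ τ ↔ s((T.src e).1, (T.tgt e).1) = s(σ, τ) := Iff.rfl

/-- Reachability from `σ` in the dual graph is constant on simplices and respects gluings, so it
descends to a continuous map from `|T|` to `Bool`, which is constant. -/
theorem dualGraph_isConnected (hT : T.IsConnectedTriangulation) :
    BranchGraph.IsConnected T.dualGraph := by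
  classical
  have hT' : ConnectedSpace T.Realization := hT
  constructor
  · obtain ⟨p⟩ := hT'.toNonempty
    obtain ⟨q, -⟩ := Quot.exists_rep p
    exact ⟨q.1, Set.mem_univ _⟩
  · intro σ _ τ _
    let g : ((_ : T.Simplex) × stdSimplex ℝ (Fin (d + 1))) → Bool := fun p =>
      decide (Relation.ReflTransGen T.dualGraph.Adj σ p.1)
    have hg : Continuous g := continuous_sigma fun σ' =>
      (continuous_const : Continuous fun _ => decide (Relation.ReflTransGen T.dualGraph.Adj σ σ'))
    have hglue : ∀ p q, T.PointGlued p q → g p = g q := by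
      rintro p q ⟨e, hp, hq, -⟩
      have hadj : T.dualGraph.Adj p.1 q.1 := ⟨e, dualGraph_isLink.2 (by rw [hp, hq])⟩
      simp only [g, decide_eq_decide]
      exact ⟨fun h => h.tail hadj, fun h => h.tail hadj.symm⟩
    let k : T.Realization → Bool := Quot.lift g hglue
    have hk : Continuous k := continuous_quot_lift hglue hg
    obtain ⟨x⟩ : Nonempty (stdSimplex ℝ (Fin (d + 1))) :=
      ⟨⟨Pi.single 0 1, single_mem_stdSimplex ℝ 0⟩⟩
    have h1 : g ⟨σ, x⟩ = g ⟨τ, x⟩ := PreconnectedSpace.constant inferInstance hk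
      (x := Quot.mk _ ⟨σ, x⟩) (y := Quot.mk _ ⟨τ, x⟩)
    simp only [g, decide_eq_decide] at h1
    exact h1.1 Relation.ReflTransGen.refl

/-! ### Vertices -/

/-- The vertex of `T` given by the `i`-th vertex of the simplex `σ`. -/
def vertex (T : GenTriangulation.{u, v} d) (σ : T.Simplex) (i : Fin (d + 1)) : T.Face 0 :=
  Quot.mk _ (σ, ⟨{i}, by simp⟩)

theorem exists_vertex_eq (v : T.Face 0) : ∃ σ i, T.vertex σ i = v := by
  obtain ⟨⟨σ, A, hA⟩, rfl⟩ := Quot.exists_rep v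
  obtain ⟨i, rfl⟩ := Finset.card_eq_one.1 (by simpa using hA)
  exact ⟨σ, i, rfl⟩

theorem vertex_src (e : T.Gluing) (k : {k : Fin (d + 1) // k ≠ (T.src e).2}) :
    T.vertex (T.src e).1 k = T.vertex (T.tgt e).1 (T.pairing e k) := by
  refine Quot.sound ⟨e, rfl, rfl, ?_, ?_, fun j => ?_⟩
  · simpa using k.2.symm
  · simpa using (T.pairing e k).2.symm
  · simp [Subtype.coe_inj]

theorem f_top (T : GenTriangulation.{u, v} d) : T.f d = Nat.card T.Simplex := by
  have hA : ∀ A : {A : Finset (Fin (d + 1)) // A.card = d + 1}, A.1 = Finset.univ := fun A =>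
    Finset.card_eq_iff_eq_univ _ |>.1 (by simpa using A.2)
  have hno : ∀ p q, ¬ T.FaceGlued d p q := by
    rintro p q ⟨e, -, -, h, -⟩
    rw [hA] at h
    exact h (Finset.mem_univ _)
  refine Nat.card_congr (Equiv.symm (Equiv.ofBijective
    (fun σ => Quot.mk _ (σ, ⟨Finset.univ, by simp⟩)) ⟨fun σ τ h => ?_, fun v => ?_⟩))
  · have := Quot.eqvGen_exact h
    have key : ∀ p q, Relation.EqvGen (T.FaceGlued d) p q → p = q := by
      intro p q hpq
      induction hpq with
      | rel _ _ h => exact (hno _ _ h).elim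
      | refl => rfl
      | symm _ _ _ ih => exact ih.symm
      | trans _ _ _ _ _ ih1 ih2 => exact ih1.trans ih2
    exact congrArg Prod.fst (key _ _ this)
  · obtain ⟨⟨σ, A⟩, rfl⟩ := Quot.exists_rep v
    exact ⟨σ, congrArg (fun B => Quot.mk _ (σ, B)) (Subtype.ext (hA A).symm)⟩

/-! ### Facets of a closed triangulation -/

/-- In a closed triangulation every facet is the source or the target of exactly one gluing. -/
noncomputable def facetEquiv (hc : T.IsClosedTriangulation) :
    T.Gluing ⊕ T.Gluing ≃ T.Simplex × Fin (d + 1) :=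
  Equiv.ofBijective (Sum.elim T.src T.tgt) ⟨T.face_used_once, fun r => by
    obtain ⟨e, he | he⟩ := hc r
    · exact ⟨Sum.inl e, he⟩
    · exact ⟨Sum.inr e, he⟩⟩

/-- The facet to which a facet is glued. -/
noncomputable def partner (hc : T.IsClosedTriangulation) : Equiv.Perm (T.Simplex × Fin (d + 1)) :=
  (facetEquiv hc).symm.trans ((Equiv.sumComm _ _).trans (facetEquiv hc))

variable (hc : T.IsClosedTriangulation)

theorem facetEquiv_inl (e : T.Gluing) : facetEquiv hc (Sum.inl e) = T.src e := rfl

theorem facetEquiv_inr (e : T.Gluing) : facetEquiv hc (Sum.inr e) = T.tgt e := rfl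

theorem partner_src (e : T.Gluing) : partner hc (T.src e) = T.tgt e := by
  rw [← facetEquiv_inl hc]
  simp [partner, facetEquiv_inr]

theorem partner_tgt (e : T.Gluing) : partner hc (T.tgt e) = T.src e := by
  rw [← facetEquiv_inr hc]
  simp [partner, facetEquiv_inl]

theorem partner_partner (x : T.Simplex × Fin (d + 1)) : partner hc (partner hc x) = x := by
  obtain ⟨e, rfl | rfl⟩ := hc x
  · rw [partner_src, partner_tgt]
  · rw [partner_tgt, partner_src]

theorem exists_vertex_partner (σ : T.Simplex) (a i : Fin (d + 1)) (hi : i ≠ a) :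
    ∃ j, T.vertex (partner hc (σ, a)).1 j = T.vertex σ i := by
  obtain ⟨e, he | he⟩ := hc (σ, a)
  · have h := vertex_src e ⟨i, by rw [he]; exact hi⟩
    rw [← he, partner_src]
    exact ⟨_, h.symm.trans (congrArg (fun p => T.vertex p.1 i) he)⟩
  · have h := vertex_src e ((T.pairing e).symm ⟨i, by rw [he]; exact hi⟩)
    rw [Equiv.apply_symm_apply] at h
    rw [← he, partner_tgt]
    exact ⟨_, h.trans (congrArg (fun p => T.vertex p.1 i) he)⟩

theorem exists_partner_of_adj {σ τ : T.Simplex} (h : T.dualGraph.Adj σ τ) :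
    ∃ a, (partner hc (σ, a)).1 = τ := by
  obtain ⟨e, he⟩ := h
  rcases Sym2.eq_iff.1 (dualGraph_isLink.1 he) with ⟨rfl, rfl⟩ | ⟨rfl, rfl⟩
  · exact ⟨(T.src e).2, by rw [Prod.mk.eta, partner_src]⟩
  · exact ⟨(T.tgt e).2, by rw [Prod.mk.eta, partner_tgt]⟩

theorem finite_gluing : Finite T.Gluing := by
  have := T.finite_simplex
  exact Finite.of_injective T.src (T.face_used_once.comp Sum.inl_injective)

theorem card_simplex_mul (hc : T.IsClosedTriangulation) :
    Nat.card T.Simplex * (d + 1) = 2 * Nat.card T.Gluing := by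
  have := T.finite_simplex
  have := T.finite_gluing
  have h := Nat.card_congr (facetEquiv hc)
  rw [Nat.card_prod, Nat.card_sum, Nat.card_fin] at h
  omega

/-! ### Counting vertices along an order of the simplices -/

section Count

variable (h : T.Simplex → ℕ) {r : T.Simplex}

/-- The number of facets of `σ` that are glued to a simplex of smaller height. -/
noncomputable def inDeg (σ : T.Simplex) : ℕ := by
  classical
  exact (Finset.univ.filter fun a => h (partner hc (σ, a)).1 < h σ).card

/-- The number of facets of `σ` that are glued to a simplex of larger height. -/
noncomputable def outDeg (σ : T.Simplex) : ℕ := by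
  classical
  exact (Finset.univ.filter fun a => h σ < h (partner hc (σ, a)).1).card

/-- The number of facets of `σ` that are glued to facets of `σ`. -/
noncomputable def loopDeg (σ : T.Simplex) : ℕ := by
  classical
  exact (Finset.univ.filter fun a => (partner hc (σ, a)).1 = σ).card

theorem inDeg_add_outDeg_add_loopDeg (hinj : Function.Injective h) (σ : T.Simplex) :
    inDeg hc h σ + outDeg hc h σ + loopDeg hc σ = d + 1 := by
  classical
  have : ∀ a, (if h (partner hc (σ, a)).1 < h σ then 1 else 0) +
      (if h σ < h (partner hc (σ, a)).1 then 1 else 0) +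
      (if (partner hc (σ, a)).1 = σ then 1 else 0) = 1 := by
    intro a
    rcases lt_trichotomy (h (partner hc (σ, a)).1) (h σ) with hlt | heq | hlt
    · have : (partner hc (σ, a)).1 ≠ σ := fun he => by rw [he] at hlt; omega
      simp [hlt, this, hlt.le]
    · simp [hinj heq]
    · have : (partner hc (σ, a)).1 ≠ σ := fun he => by rw [he] at hlt; omega
      simp [hlt, this, hlt.le]
  simp only [inDeg, outDeg, loopDeg, Finset.card_filter, ← Finset.sum_add_distrib, this]
  simp

theorem sum_inDeg_eq_sum_outDeg [Fintype T.Simplex] :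
    ∑ σ, inDeg hc h σ = ∑ σ, outDeg hc h σ := by
  classical
  simp only [inDeg, outDeg, Finset.card_filter]
  rw [← Fintype.sum_prod_type' (f := fun σ a => if h (partner hc (σ, a)).1 < h σ then 1 else 0),
    ← Fintype.sum_prod_type' (f := fun σ a => if h σ < h (partner hc (σ, a)).1 then 1 else 0),
    ← Equiv.sum_comp (partner hc)]
  refine Finset.sum_congr rfl fun x _ => ?_
  simp [partner_partner]

theorem sum_loopDeg [Fintype T.Simplex] :
    ∑ σ, loopDeg hc σ = 2 * {e | ∃ σ, T.dualGraph.IsLink e σ σ}.ncard := by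
  classical
  have := T.finite_gluing
  have := Fintype.ofFinite T.Gluing
  have hL : {e | ∃ σ, T.dualGraph.IsLink e σ σ} = {e | (T.src e).1 = (T.tgt e).1} := by
    ext e
    simp only [dualGraph_isLink, Sym2.eq_iff, Set.mem_ofPred_eq]
    constructor
    · rintro ⟨σ, ⟨h1, h2⟩ | ⟨h1, h2⟩⟩ <;> rw [h1, h2]
    · intro h
      exact ⟨_, Or.inl ⟨h, rfl⟩⟩
  rw [hL, Set.ncard_eq_toFinset_card']
  simp only [loopDeg, Finset.card_filter]
  rw [← Fintype.sum_prod_type' (f := fun σ a => if (partner hc (σ, a)).1 = σ then 1 else 0),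
    ← Equiv.sum_comp (facetEquiv hc), Fintype.sum_sum_type]
  simp only [facetEquiv_inl, facetEquiv_inr, Prod.mk.eta, partner_src, partner_tgt,
    Set.toFinset_ofPred, Finset.card_filter, two_mul]
  simp only [eq_comm]

theorem ncard_range_vertex_le (r : T.Simplex) : (Set.range (T.vertex r)).ncard ≤ d + 1 := by
  rw [← Set.image_univ]
  refine (Set.ncard_image_le (Set.toFinite _)).trans ?_
  simp [Set.ncard_univ]

/-- The two glued facets of `r` differ, so the target facet contains the vertex opposite the source
facet. The pairing identifies that vertex with another vertex of `r`. -/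
theorem ncard_range_vertex_le_of_loop {e : T.Gluing} (he : T.dualGraph.IsLink e r r) :
    (Set.range (T.vertex r)).ncard ≤ d := by
  obtain ⟨h1, h2⟩ : (T.src e).1 = r ∧ (T.tgt e).1 = r := by
    rcases Sym2.eq_iff.1 (dualGraph_isLink.1 he) with h | h <;> exact h
  have hne : (T.src e).2 ≠ (T.tgt e).2 := by
    intro hcon
    have : T.src e = T.tgt e := Prod.ext (h1.trans h2.symm) hcon
    have := @T.face_used_once (Sum.inl e) (Sum.inr e) this
    simp at this
  set k := (T.pairing e).symm ⟨(T.src e).2, hne⟩ with hk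
  have hv := vertex_src e k
  rw [h1, h2, hk, Equiv.apply_symm_apply, ← hk] at hv
  have hsub : Set.range (T.vertex r) ⊆ T.vertex r '' {(T.src e).2}ᶜ := by
    rintro _ ⟨i, rfl⟩
    by_cases hi : i = (T.src e).2
    · exact ⟨k, k.2, by rw [hv, hi]⟩
    · exact ⟨i, hi, rfl⟩
  refine (Set.ncard_le_ncard hsub (Set.toFinite _)).trans
    ((Set.ncard_image_le (Set.toFinite _)).trans ?_)
  rw [Set.ncard_compl, Set.ncard_singleton, Nat.card_fin]
  omega

/-- A vertex that is not in the source `r` is new only in a simplex with in-degree one. -/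
theorem f_zero_le (hdown : ∀ σ, σ ≠ r → ∃ τ, T.dualGraph.Adj τ σ ∧ h τ < h σ) :
    T.f 0 ≤ (Set.range (T.vertex r)).ncard + {σ | σ ≠ r ∧ inDeg hc h σ = 1}.ncard := by
  classical
  have := T.finite_simplex
  have ha : ∀ σ, ∃ a, inDeg hc h σ = 1 →
      (Finset.univ.filter fun a => h (partner hc (σ, a)).1 < h σ) = {a} := by
    intro σ
    by_cases hσ : inDeg hc h σ = 1
    · obtain ⟨a, ha⟩ := Finset.card_eq_one.1 hσ
      exact ⟨a, fun _ => ha⟩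
    · exact ⟨0, fun h => (hσ h).elim⟩
  choose a ha using ha
  have hcover : (Set.univ : Set (T.Face 0)) ⊆ Set.range (T.vertex r) ∪
      (fun σ => T.vertex σ (a σ)) '' {σ | σ ≠ r ∧ inDeg hc h σ = 1} := by
    intro v _
    obtain ⟨σ, ⟨i, hi⟩, hmin⟩ := Set.exists_min_image {σ | ∃ i, T.vertex σ i = v} h (Set.toFinite _)
      (exists_vertex_eq v)
    by_cases hσ : σ = r
    · subst hσ
      exact Or.inl ⟨i, hi⟩
    · right
      -- Otherwise the lower neighbour across facet `b` would contain `v` too.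
      have hin : ∀ b, h (partner hc (σ, b)).1 < h σ → b = i := by
        intro b hb
        by_contra hne
        obtain ⟨j, hj⟩ := exists_vertex_partner hc σ b i (Ne.symm hne)
        exact absurd (hmin _ ⟨j, hj.trans hi⟩) (not_le.2 hb)
      obtain ⟨τ, hτ, hlt⟩ := hdown σ hσ
      obtain ⟨b, rfl⟩ := exists_partner_of_adj hc hτ.symm
      obtain rfl := hin b hlt
      have hf : (Finset.univ.filter fun a => h (partner hc (σ, a)).1 < h σ) = {b} := by
        ext b'
        simp only [Finset.mem_filter, Finset.mem_univ, true_and, Finset.mem_singleton]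
        exact ⟨hin b', fun h => h ▸ hlt⟩
      have h1 : inDeg hc h σ = 1 := Finset.card_eq_one.2 ⟨b, hf⟩
      refine ⟨σ, ⟨hσ, h1⟩, ?_⟩
      have : b = a σ := Finset.singleton_injective (hf.symm.trans (ha σ h1))
      change T.vertex σ (a σ) = v
      rw [← this, hi]
  have hfin : (Set.range (T.vertex r) ∪
      (fun σ => T.vertex σ (a σ)) '' {σ | σ ≠ r ∧ inDeg hc h σ = 1}).Finite := Set.toFinite _
  rw [f, ← Set.ncard_univ]
  refine (Set.ncard_le_ncard hcover hfin).trans ((Set.ncard_union_le _ _).trans ?_)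
  gcongr
  exact Set.ncard_image_le (Set.toFinite _)

theorem inDeg_source
    (hdown : ∀ σ, σ ≠ r → ∃ τ, T.dualGraph.Adj τ σ ∧ h τ < h σ) : inDeg hc h r = 0 := by
  classical
  have := T.finite_simplex
  obtain ⟨σ, -, hmin⟩ := Set.exists_min_image Set.univ h (Set.toFinite _) ⟨r, trivial⟩
  have hσ : σ = r := by
    by_contra hσ
    obtain ⟨τ, -, hlt⟩ := hdown σ hσ
    exact absurd (hmin τ trivial) (not_le.2 hlt)
  subst hσ
  refine Finset.card_eq_zero.2 (Finset.filter_eq_empty_iff.2 fun a _ => ?_)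
  exact not_lt.2 (hmin _ trivial)

theorem inDeg_pos {σ : T.Simplex} (hdown : ∃ τ, T.dualGraph.Adj τ σ ∧ h τ < h σ) :
    0 < inDeg hc h σ := by
  classical
  obtain ⟨τ, hτ, hlt⟩ := hdown
  obtain ⟨b, rfl⟩ := exists_partner_of_adj hc hτ.symm
  exact Finset.card_pos.2 ⟨b, by simpa using hlt⟩

theorem mem_sinks {σ : T.Simplex} (hσ : σ ≠ r) (hout : outDeg hc h σ = 0)
    (hloop : loopDeg hc σ = 0) : σ ∈ BranchGraph.sinks T.dualGraph r h := by
  classical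
  refine ⟨hσ, fun e he => ?_, fun τ hτ => ?_⟩
  · obtain ⟨a, ha⟩ := exists_partner_of_adj hc he.adj
    have := Finset.filter_eq_empty_iff.1 (Finset.card_eq_zero.1 hloop) (Finset.mem_univ a)
    exact this ha
  · obtain ⟨a, rfl⟩ := exists_partner_of_adj hc hτ
    have := Finset.filter_eq_empty_iff.1 (Finset.card_eq_zero.1 hout) (Finset.mem_univ a)
    exact not_lt.1 this

theorem inDeg_eq_one_bound (hinj : Function.Injective h)
    (hdown : ∀ σ, σ ≠ r → ∃ τ, T.dualGraph.Adj τ σ ∧ h τ < h σ) :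
    2 * ((d : ℤ) - 1) * {σ | σ ≠ r ∧ inDeg hc h σ = 1}.ncard + 2 * d ≤
      ((d : ℤ) - 1) * Nat.card T.Simplex + 2 * (BranchGraph.sinks T.dualGraph r h).ncard +
        2 * {e | ∃ σ, T.dualGraph.IsLink e σ σ}.ncard := by
  classical
  have := T.finite_simplex
  have := Fintype.ofFinite T.Simplex
  -- The weights make this tight at `r` (in-degree `0`) and, if neither node is in `sinks`, at
  -- in-degree `1`. Otherwise a node with an outgoing or loop facet has in-degree at most `d`, hence
  -- surplus at most `d - 1`; a loopless sink has in-degree `d + 1`, which costs the extra `2`.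
  have key : ∀ σ, (inDeg hc h σ : ℤ) + 2 * (d - 1) * (if σ ≠ r ∧ inDeg hc h σ = 1 then 1 else 0) +
      2 * d * (if σ = r then 1 else 0) ≤ outDeg hc h σ + (d - 1) +
        2 * (if σ ∈ BranchGraph.sinks T.dualGraph r h then 1 else 0) + loopDeg hc σ := by
    intro σ
    have hsum := inDeg_add_outDeg_add_loopDeg hc h hinj σ
    by_cases hσ : σ = r
    · subst hσ
      have h0 := inDeg_source hc h hdown
      rw [h0] at hsum ⊢
      simp only [ne_eq, not_true_eq_false, false_and, if_false, if_true]
      split_ifs <;> push_cast <;> omega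
    · have hpos := inDeg_pos hc h (hdown σ hσ)
      by_cases h1 : inDeg hc h σ = 1
      · rw [h1] at hsum ⊢
        simp only [ne_eq, hσ, not_false_eq_true, true_and, if_true, if_false]
        split_ifs <;> push_cast <;> omega
      · simp only [h1, hσ, and_false, if_false]
        by_cases hs : outDeg hc h σ = 0 ∧ loopDeg hc σ = 0
        · rw [if_pos (mem_sinks hc h hσ hs.1 hs.2)]
          omega
        · split_ifs <;> omega
  have hs := Finset.sum_le_sum fun σ (_ : σ ∈ Finset.univ) => key σ
  simp only [Finset.sum_add_distrib, ← Finset.mul_sum, Finset.sum_boole, Finset.sum_const,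
    Finset.card_univ, nsmul_eq_mul] at hs
  have e1 : ∑ σ, (inDeg hc h σ : ℤ) = ∑ σ, (outDeg hc h σ : ℤ) := by
    exact_mod_cast sum_inDeg_eq_sum_outDeg hc h
  have e2 : ∑ σ, (loopDeg hc σ : ℤ) = 2 * {e | ∃ σ, T.dualGraph.IsLink e σ σ}.ncard := by
    exact_mod_cast sum_loopDeg hc
  have e3 : {σ | σ ≠ r ∧ inDeg hc h σ = 1}.ncard =
      (Finset.univ.filter fun σ => σ ≠ r ∧ inDeg hc h σ = 1).card := by
    rw [Set.ncard_eq_toFinset_card', Set.toFinset_ofPred]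
  have e4 : (BranchGraph.sinks T.dualGraph r h).ncard =
      (Finset.univ.filter fun σ => σ ∈ BranchGraph.sinks T.dualGraph r h).card := by
    rw [Set.ncard_eq_toFinset_card']
    congr 1
    ext; simp
  have e5 : (Finset.univ.filter fun σ : T.Simplex => σ = r).card = 1 := by
    rw [Finset.filter_eq' Finset.univ r]; simp
  rw [e3, e4, Nat.card_eq_fintype_card]
  rw [e1, e2, e5] at hs
  push_cast at hs
  linarith

end Count

/-- The bound on `δ_T` in integral form, for a triangulation with `2 * m` simplices. -/
theorem mul_delta_le {m : ℕ} (hd : 2 ≤ d) (hc : T.IsClosedTriangulation)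
    (hT : T.IsConnectedTriangulation) (hm : Nat.card T.Simplex = 2 * m) :
    ((d : ℤ) - 1) * (T.f 0 - m - d) ≤ (BranchGraph.branch T.dualGraph : ℤ) - 2 := by
  have := T.finite_simplex
  have := T.finite_gluing
  have hG := dualGraph_isConnected hT
  -- The number of simplices is even and positive.
  have : Nontrivial T.Simplex := by
    rw [← Finite.one_lt_card_iff_nontrivial]
    obtain ⟨σ, -⟩ := hG.1
    have : Nonempty T.Simplex := ⟨σ⟩
    have : 0 < Nat.card T.Simplex := Nat.card_pos
    omega
  obtain ⟨r, h, hinj, hdown, hb⟩ := BranchGraph.exists_order_le_branch hG rfl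
  have hf := f_zero_le hc h hdown
  have hI := inDeg_eq_one_bound hc h hinj hdown
  set a := {σ | σ ≠ r ∧ inDeg hc h σ = 1}.ncard
  set s := (BranchGraph.sinks T.dualGraph r h).ncard
  set l := {e | ∃ σ, T.dualGraph.IsLink e σ σ}.ncard
  set b := BranchGraph.branch T.dualGraph
  rw [hm] at hI
  push_cast at hI
  have hd' : (0 : ℤ) ≤ (d : ℤ) - 1 := by omega
  rcases hb with hb | ⟨⟨e, he⟩, hb⟩
  · have hr := ncard_range_vertex_le r
    have h1 : (T.f 0 : ℤ) - m - d ≤ a - m + 1 := by omega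
    have h2 := mul_le_mul_of_nonneg_left h1 hd'
    have hb' : (s : ℤ) + l + 1 ≤ b := by exact_mod_cast hb
    linarith
  -- The vertex lost to the loop at `r` saves `d - 1 ≥ 1`, which pays for the missing `+ 1` in the
  -- bound on `s + l`.
  · have hr := ncard_range_vertex_le_of_loop he
    have h1 : (T.f 0 : ℤ) - m - d ≤ a - m := by omega
    have h2 := mul_le_mul_of_nonneg_left h1 hd'
    have hb' : (s : ℤ) + l ≤ b := by exact_mod_cast hb
    have hd2 : (2 : ℤ) ≤ d := by exact_mod_cast hd
    linarith

end GenTriangulation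

theorem mainTheorem1 {d : ℕ} (hd : Even d) (hd0 : 0 < d) (T : GenTriangulation.{u, v} d)
    (hclosed : T.IsClosedTriangulation) (hconn : T.IsConnectedTriangulation) :
    T.delta ≤ (d : ℚ) + (⌊((BranchGraph.branch T.dualGraph : ℚ) - 2) / ((d : ℚ) - 1)⌋ : ℚ) ∧
    (BranchGraph.branch T.dualGraph ≤ d → (T.f 0 : ℚ) ≤ (T.f d : ℚ) / 2 + (d : ℚ)) := by
  have hd2 : 2 ≤ d := by
    obtain ⟨k, rfl⟩ := hd
    omega
  obtain ⟨m, hm⟩ : ∃ m, Nat.card T.Simplex = 2 * m := by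
    -- Facets are glued in pairs, and `d + 1` is odd.
    have h2 : 2 ∣ Nat.card T.Simplex * (d + 1) :=
      ⟨_, GenTriangulation.card_simplex_mul hclosed⟩
    exact (Nat.Coprime.dvd_of_dvd_mul_right
      (Nat.coprime_two_left.2 hd.add_one) h2)
  have hmain := GenTriangulation.mul_delta_le hd2 hclosed hconn hm
  have hdq : (0 : ℚ) < (d : ℚ) - 1 := by
    have : (2 : ℚ) ≤ d := by exact_mod_cast hd2
    linarith
  have hdelta : T.delta = ((T.f 0 - m : ℤ) : ℚ) := by
    rw [GenTriangulation.delta, GenTriangulation.f_top, hm]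
    push_cast
    ring
  have hfloor : ((T.f 0 : ℤ) - m - d) ≤
      ⌊((BranchGraph.branch T.dualGraph : ℚ) - 2) / ((d : ℚ) - 1)⌋ := by
    rw [Int.le_floor, le_div_iff₀ hdq, mul_comm]
    exact_mod_cast hmain
  have h1 : T.delta ≤
      (d : ℚ) + (⌊((BranchGraph.branch T.dualGraph : ℚ) - 2) / ((d : ℚ) - 1)⌋ : ℚ) := by
    rw [hdelta]
    have : (((T.f 0 : ℤ) - m - d : ℤ) : ℚ) ≤
        (⌊((BranchGraph.branch T.dualGraph : ℚ) - 2) / ((d : ℚ) - 1)⌋ : ℚ) := by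
      exact_mod_cast hfloor
    push_cast at this ⊢
    linarith
  refine ⟨h1, fun hb => ?_⟩
  have h0 : ⌊((BranchGraph.branch T.dualGraph : ℚ) - 2) / ((d : ℚ) - 1)⌋ ≤ 0 := by
    rw [← Int.lt_add_one_iff, Int.floor_lt, div_lt_iff₀ hdq]
    have : (BranchGraph.branch T.dualGraph : ℚ) ≤ d := by exact_mod_cast hb
    push_cast
    linarith
  have h0' : (⌊((BranchGraph.branch T.dualGraph : ℚ) - 2) / ((d : ℚ) - 1)⌋ : ℚ) ≤ 0 := by
    exact_mod_cast h0
  rw [GenTriangulation.delta] at h1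
  linarith
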